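/- All graphs are finite and simple. For a graph $G$, let $\chi(G)$ be its chromatic number and $\alpha(G)$ its independence number. For integers $m,n\ge 0$ let $K^{m}_{m,n}$ be the graph obtained from the complete bipartite graph $K_{m,n}$ by making every two distinct vertices on the side of size $m$ adjacent. A graph $H$ is a minor of $G$, written $G\succeq_m H$, if a graph isomorphic to $H$ can be obtained from $G$ by deleting vertices or edges and contracting edges; equivalently, if there are pairwise disjoint nonempty vertex sets $(B_w)_{w\in V(H)}$ of $G$, each inducing a connected subgraph, such that $G$ has an edge between $B_w$ and $B_{w'}$ for every edge $ww'$ of $H$. Theorem. The following two statements are equivalent. (A) For every $n$-vertex graph $G$ with $\alpha(G)=2$ and every positive integer $\ell$ with $2\ell\le\lceil n/2\rceil$, we have $G\succeq_m K^{\ell}_{\ell,\lceil n/2\rceil-\ell}$. (B) For every graph $G$ with $\alpha(G)\le 2$ and every positive integer $\ell$ with $2\ell\le\chi(G)$, we have $G\succeq_m K^{\ell}_{\ell,\chi(G)-\ell}$. -/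

import Mathlib

/-!
If `G` is not `k`-colorable and has at most `2k` vertices, then the complement of `G`, padded with
`2k - |V|` universal vertices, has no perfect matching: matched pairs would be color classes.
Tutte's theorem then yields vertex sets `S i`, the components left after deleting a violator, which
are complete to each other in `G` and satisfy `∑ ⌈|S i| / 2⌉ > k`. The order version provides a
minor with `⌈|S i| / 2⌉` branch sets inside every `S i`, half of them dominating, and these minors
are joined. Rounding down the halves loses a dominating branch set when two of the numbers of
branch sets are odd; it is recovered by giving up one branch set, that is two vertices, on each
side and using the four vertices as two edges between the sides, since an edge between two sets
that are complete to each other dominates both of them.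
-/

universe u

namespace SimpleGraph

/-- `H` is a minor of `G`: there are pairwise disjoint vertex sets `B w` of `G`, one for each vertex
`w` of `H`, each inducing a (nonempty) connected subgraph of `G`, such that for every edge `w w'`
of `H` there is an edge of `G` between `B w` and `B w'`. Contracting each `B w` to a vertex
and deleting what is superfluous yields `H`. -/
def IsGraphMinor {W : Type*} {V : Type*} (H : SimpleGraph W) (G : SimpleGraph V) : Prop :=
  ∃ B : W → Set V,
    (∀ w, (G.induce (B w)).Connected) ∧
    (∀ w w', w ≠ w' → Disjoint (B w) (B w')) ∧
    (∀ w w', H.Adj w w' → ∃ x ∈ B w, ∃ y ∈ B w', G.Adj x y)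

/-- The graph `K^m_{m,n}`: the complete bipartite graph `K_{m,n}` together with all edges between
distinct vertices of the side of size `m`. -/
def cliqueBipartite (m n : ℕ) : SimpleGraph (Fin m ⊕ Fin n) :=
  completeBipartiteGraph (Fin m) (Fin n) ⊔
    (⊤ : SimpleGraph (Fin m)).map (Function.Embedding.inl : Fin m ↪ Fin m ⊕ Fin n)

/-- The `n`-vertex version: every finite graph `G` on `n` vertices with `α(G) = 2` has a
`K^ℓ_{ℓ,⌈n/2⌉-ℓ}` minor for every positive integer `ℓ` with `2ℓ ≤ ⌈n/2⌉`. -/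
def OrderVersion : Prop :=
  ∀ (V : Type u) [Fintype V] (G : SimpleGraph V), G.indepNum = 2 →
    ∀ ℓ : ℕ, 0 < ℓ → 2 * ℓ ≤ ⌈(Fintype.card V : ℚ) / 2⌉₊ →
      (cliqueBipartite ℓ (⌈(Fintype.card V : ℚ) / 2⌉₊ - ℓ)).IsGraphMinor G

/-- The chromatic-number version: every finite graph `G` with `α(G) ≤ 2` and `χ(G) = k` has a
`K^ℓ_{ℓ,k-ℓ}` minor for every positive integer `ℓ` with `2ℓ ≤ k`. -/
def ChromaticVersion : Prop :=
  ∀ (V : Type u) [Fintype V] (G : SimpleGraph V), G.indepNum ≤ 2 →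
    ∀ k : ℕ, G.chromaticNumber = (k : ℕ∞) →
      ∀ ℓ : ℕ, 0 < ℓ → 2 * ℓ ≤ k → (cliqueBipartite ℓ (k - ℓ)).IsGraphMinor G

end SimpleGraph

open SimpleGraph

section DominatingModel

variable {V : Type*} {G : SimpleGraph V} {S T : Set V} {A B F E : Finset (Set V)} {a b k m : ℕ}

/-- A model in `G[S]` of a complete graph minus edges that avoid a set of dominating vertices: `F`
is the set of branch sets and `A` consists of those that represent the dominating vertices. It is
unindexed, so that models can be united and shrunk without reindexing. -/
structure IsDominatingModel (G : SimpleGraph V) (S : Set V) (A F : Finset (Set V)) : Prop where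
  subset : A ⊆ F
  branch_subset : ∀ X ∈ F, X ⊆ S
  connected : ∀ X ∈ F, (G.induce X).Connected
  disjoint : (F : Set (Set V)).PairwiseDisjoint id
  exists_adj : ∀ X ∈ A, ∀ Y ∈ F, X ≠ Y → ∃ x ∈ X, ∃ y ∈ Y, G.Adj x y

/-- `G[S]` has a model with `k` branch sets, `a` of which are dominating. For `S = Set.univ` this
says that `K^a_{a,k-a}` is a minor of `G`. -/
def HasDominatingModel (G : SimpleGraph V) (S : Set V) (a k : ℕ) : Prop :=
  ∃ A F, IsDominatingModel G S A F ∧ A.card = a ∧ F.card = k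

namespace IsDominatingModel

lemma nonempty (hF : IsDominatingModel G S A F) {X : Set V} (hX : X ∈ F) : X.Nonempty :=
  Set.nonempty_coe_sort.1 (hF.connected X hX).nonempty

lemma disjoint_of_disjoint (hF : IsDominatingModel G S A F) (hE : IsDominatingModel G T B E)
    (hST : Disjoint S T) : Disjoint F E := by
  refine Finset.disjoint_left.2 fun X hXF hXE => ?_
  obtain ⟨x, hx⟩ := hF.nonempty hXF
  exact Set.disjoint_left.1 hST (hF.branch_subset X hXF hx) (hE.branch_subset X hXE hx)

lemma union [DecidableEq (Set V)] (hF : IsDominatingModel G S A F)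
    (hE : IsDominatingModel G T B E) (hST : Disjoint S T)
    (hFE : ∀ X ∈ F, ∀ Y ∈ E, ∃ x ∈ X, ∃ y ∈ Y, G.Adj x y) :
    IsDominatingModel G (S ∪ T) (A ∪ B) (F ∪ E) where
  subset := Finset.union_subset_union hF.subset hE.subset
  branch_subset X hX := (Finset.mem_union.1 hX).elim
    (fun h => (hF.branch_subset X h).trans Set.subset_union_left)
    (fun h => (hE.branch_subset X h).trans Set.subset_union_right)
  connected X hX := (Finset.mem_union.1 hX).elim (hF.connected X) (hE.connected X)
  disjoint := by
    rw [Finset.coe_union, Set.pairwiseDisjoint_union]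
    exact ⟨hF.disjoint, hE.disjoint, fun X hX Y hY _ =>
      hST.mono (hF.branch_subset X hX) (hE.branch_subset Y hY)⟩
  exists_adj X hX Y hY hne := by
    rcases Finset.mem_union.1 hX with hX | hX <;> rcases Finset.mem_union.1 hY with hY | hY
    · exact hF.exists_adj X hX Y hY hne
    · exact hFE X (hF.subset hX) Y hY
    · obtain ⟨y, hy, x, hx, h⟩ := hFE Y hY X (hE.subset hX)
      exact ⟨x, hx, y, hy, h.symm⟩
    · exact hE.exists_adj X hX Y hY hne

lemma hasDominatingModel_union (hF : IsDominatingModel G S A F) (hE : IsDominatingModel G T B E)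
    (hST : Disjoint S T) (hFE : ∀ X ∈ F, ∀ Y ∈ E, ∃ x ∈ X, ∃ y ∈ Y, G.Adj x y) :
    HasDominatingModel G (S ∪ T) (A.card + B.card) (F.card + E.card) := by
  classical
  have hdisj : Disjoint F E := hF.disjoint_of_disjoint hE hST
  exact ⟨A ∪ B, F ∪ E, hF.union hE hST hFE,
    Finset.card_union_of_disjoint (hdisj.mono hF.subset hE.subset),
    Finset.card_union_of_disjoint hdisj⟩

end IsDominatingModel

lemma isDominatingModel_singleton {Z : Set V} (hZ : (G.induce Z).Connected) :
    IsDominatingModel G Z {Z} {Z} where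
  subset := subset_rfl
  branch_subset := by simp
  connected := by simpa using hZ
  disjoint := by simp
  exists_adj := by simp

lemma connected_induce_image {W : Type*} {H : SimpleGraph W} (φ : H →g G) {X : Set W}
    (hX : (H.induce X).Connected) : (G.induce (φ '' X)).Connected :=
  hX.map (induceHom φ (Set.mapsTo_image φ X)) (Set.surjective_mapsTo_image_restrict φ X)

namespace HasDominatingModel

lemma mono (h : HasDominatingModel G S a k) (hST : S ⊆ T) : HasDominatingModel G T a k := by
  obtain ⟨A, F, hF, hA, hk⟩ := h
  exact ⟨A, F, { hF with branch_subset := fun X hX => (hF.branch_subset X hX).trans hST }, hA, hk⟩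

lemma of_le (h : HasDominatingModel G S a k) (hb : b ≤ a) (hm : m ≤ k) (hbm : b ≤ m) :
    HasDominatingModel G S b m := by
  obtain ⟨A, F, hF, rfl, rfl⟩ := h
  obtain ⟨A', hA', rfl⟩ := Finset.exists_subset_card_eq hb
  obtain ⟨F', hAF', hF', rfl⟩ :=
    Finset.exists_subsuperset_card_eq (hA'.trans hF.subset) hbm hm
  exact ⟨A', F',
    { subset := hAF'
      branch_subset := fun X hX => hF.branch_subset X (hF' hX)
      connected := fun X hX => hF.connected X (hF' hX)
      disjoint := hF.disjoint.subset (Finset.coe_subset.2 hF')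
      exists_adj := fun X hX Y hY => hF.exists_adj X (hA' hX) Y (hF' hY) }, rfl, rfl⟩

lemma map {W : Type*} {H : SimpleGraph W} {S : Set W} (h : HasDominatingModel H S a k)
    (φ : H ↪g G) : HasDominatingModel G (φ '' S) a k := by
  obtain ⟨A, F, hF, rfl, rfl⟩ := h
  let image : Set W ↪ Set V := ⟨(φ '' ·), φ.injective.image_injective⟩
  refine ⟨A.map image, F.map image, ⟨Finset.map_subset_map.2 hF.subset, ?_, ?_, ?_, ?_⟩,
    Finset.card_map _, Finset.card_map _⟩
  · simp only [Finset.forall_mem_map]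
    exact fun X hX => Set.image_mono (hF.branch_subset X hX)
  · simp only [Finset.forall_mem_map]
    exact fun X hX => connected_induce_image φ.toHom (hF.connected X hX)
  · rw [Finset.coe_map, Set.InjOn.pairwiseDisjoint_image image.injective.injOn]
    exact fun X hX Y hY hne =>
      (Set.disjoint_image_iff φ.injective).2 (hF.disjoint hX hY hne)
  · simp only [Finset.forall_mem_map]
    intro X hX Y hY hne
    obtain ⟨x, hx, y, hy, hxy⟩ := hF.exists_adj X hX Y hY fun h => hne (h ▸ rfl)
    exact ⟨φ x, ⟨x, hx, rfl⟩, φ y, ⟨y, hy, rfl⟩, φ.map_adj_iff.2 hxy⟩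

lemma join (hS : HasDominatingModel G S a k) (hT : HasDominatingModel G T b m)
    (hST : G.IsCompleteBetween S T) : HasDominatingModel G (S ∪ T) (a + b) (k + m) := by
  obtain ⟨A, F, hF, rfl, rfl⟩ := hS
  obtain ⟨B, E, hE, rfl, rfl⟩ := hT
  refine hF.hasDominatingModel_union hE hST.disjoint fun X hX Y hY => ?_
  obtain ⟨x, hx⟩ := hF.nonempty hX
  obtain ⟨y, hy⟩ := hE.nonempty hY
  exact ⟨x, hx, y, hy, hST (hF.branch_subset X hX hx) (hE.branch_subset Y hY hy)⟩

lemma union_dominating (hS : HasDominatingModel G S a k) {Z : Set V}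
    (hZ : (G.induce Z).Connected) (hSZ : Disjoint S Z) (hdom : ∀ x ∈ S, ∃ z ∈ Z, G.Adj x z) :
    HasDominatingModel G (S ∪ Z) (a + 1) (k + 1) := by
  obtain ⟨A, F, hF, rfl, rfl⟩ := hS
  refine hF.hasDominatingModel_union (isDominatingModel_singleton hZ) hSZ fun X hX Y hY => ?_
  obtain rfl := Finset.mem_singleton.1 hY
  obtain ⟨x, hx⟩ := hF.nonempty hX
  exact ⟨x, hx, hdom x (hF.branch_subset X hX hx)⟩

lemma insert_edge {u v : V} (h : HasDominatingModel G (S ∪ T) a k)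
    (hST : G.IsCompleteBetween (insert u S) (insert v T)) (hu : u ∉ S) (hv : v ∉ T) :
    HasDominatingModel G (insert u S ∪ insert v T) (a + 1) (k + 1) := by
  have huv : G.Adj u v := hST (.inl rfl) (.inl rfl)
  have hnotMem_left : v ∉ S := fun h => (hST (.inr h) (.inl rfl)).ne rfl
  have hnotMem_right : u ∉ T := fun h => (hST (.inl rfl) (.inr h)).ne rfl
  have hdisj : Disjoint (S ∪ T) {u, v} := by
    simp only [Set.disjoint_insert_right, Set.disjoint_singleton_right, Set.mem_union]
    tauto
  have hdom : ∀ x ∈ S ∪ T, ∃ z ∈ ({u, v} : Set V), G.Adj x z := by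
    rintro x (hx | hx)
    · exact ⟨v, .inr rfl, hST (.inr hx) (.inl rfl)⟩
    · exact ⟨u, .inl rfl, (hST (.inl rfl) (.inr hx)).symm⟩
  refine (h.union_dominating (induce_pair_connected_of_adj huv) hdisj hdom).mono ?_
  rintro x ((hx | hx) | hx | hx)
  exacts [.inl (.inr hx), .inr (.inr hx), .inl (.inl hx), .inr (.inl hx)]

end HasDominatingModel

lemma hasDominatingModel_of_forall_adj {s t : Finset V} (hts : t ⊆ s)
    (hadj : ∀ x ∈ t, ∀ y ∈ s, x ≠ y → G.Adj x y) : HasDominatingModel G s t.card s.card := by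
  let single : V ↪ Set V := ⟨fun v => {v}, Set.singleton_injective⟩
  refine ⟨t.map single, s.map single, ⟨Finset.map_subset_map.2 hts, ?_, ?_, ?_, ?_⟩,
    Finset.card_map _, Finset.card_map _⟩
  · simp only [Finset.forall_mem_map]
    exact fun v hv => Set.singleton_subset_iff.2 hv
  · simp only [Finset.forall_mem_map]
    exact fun v _ => (⟨.of_subsingleton⟩ : (G.induce {v}).Connected)
  · rw [Finset.coe_map, Set.InjOn.pairwiseDisjoint_image single.injective.injOn]
    exact fun v _ w _ hne => Set.disjoint_singleton.2 hne
  · simp only [Finset.forall_mem_map]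
    exact fun v hv w hw hne => ⟨v, rfl, w, rfl, hadj v hv w hw fun h => hne (h ▸ rfl)⟩

lemma cliqueBipartite_adj {x y : Fin a ⊕ Fin b} :
    (cliqueBipartite a b).Adj x y ↔ x ≠ y ∧ (x.isLeft ∨ y.isLeft) := by
  rcases x with i | i <;> rcases y with j | j <;> simp [cliqueBipartite]

lemma HasDominatingModel.isGraphMinor (h : HasDominatingModel G S a (a + b)) :
    (cliqueBipartite a b).IsGraphMinor G := by
  classical
  obtain ⟨A, F, hF, hA, hFcard⟩ := h
  have hFA : (F \ A).card = b := by rw [Finset.card_sdiff_of_subset hF.subset]; omega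
  let eA := A.equivFinOfCardEq hA
  let eF := (F \ A).equivFinOfCardEq hFA
  let f : Fin a ⊕ Fin b → Set V := Sum.elim (fun i => eA.symm i) (fun j => eF.symm j)
  have hinj : f.Injective := by
    refine (Subtype.val_injective.comp eA.symm.injective).sumElim
      (Subtype.val_injective.comp eF.symm.injective) fun i j hij => ?_
    have hij : ((eA.symm i : A) : Set V) = (eF.symm j : (F \ A : Finset (Set V))) := hij
    exact (Finset.mem_sdiff.1 (eF.symm j).2).2 (hij ▸ (eA.symm i).2)
  have hfA : ∀ w : Fin a ⊕ Fin b, w.isLeft → f w ∈ A := by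
    rintro (i | j) hw
    · exact (eA.symm i).2
    · simp at hw
  have hfF : ∀ w, f w ∈ F := by
    rintro (i | j)
    · exact hF.subset (eA.symm i).2
    · exact (Finset.mem_sdiff.1 (eF.symm j).2).1
  refine ⟨f, fun w => hF.connected _ (hfF w),
    fun w w' hne => hF.disjoint (hfF w) (hfF w') (hinj.ne hne), fun w w' hadj => ?_⟩
  obtain ⟨hne, hw | hw⟩ := cliqueBipartite_adj.1 hadj
  · exact hF.exists_adj _ (hfA w hw) _ (hfF w') (hinj.ne hne)
  · obtain ⟨x, hx, y, hy, hxy⟩ := hF.exists_adj _ (hfA w' hw) _ (hfF w) (hinj.ne hne.symm)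
    exact ⟨y, hy, x, hx, hxy.symm⟩

lemma hasDominatingModel_of_isGraphMinor (h : (cliqueBipartite a b).IsGraphMinor G) :
    HasDominatingModel G Set.univ a (a + b) := by
  obtain ⟨f, hconn, hdisj, hadj⟩ := h
  have hinj : f.Injective := by
    intro w w' heq
    by_contra hne
    obtain ⟨x, hx⟩ := Set.nonempty_coe_sort.1 (hconn w).nonempty
    exact Set.disjoint_left.1 (hdisj w w' hne) hx (heq ▸ hx)
  let branch : Fin a ⊕ Fin b ↪ Set V := ⟨f, hinj⟩
  refine ⟨(Finset.univ.map .inl).map branch, Finset.univ.map branch,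
    ⟨Finset.map_subset_map.2 (Finset.subset_univ _), fun _ _ => Set.subset_univ _, ?_, ?_, ?_⟩,
    by simp, by simp⟩
  · simp only [Finset.forall_mem_map]
    exact fun w _ => hconn w
  · rw [Finset.coe_map, Set.InjOn.pairwiseDisjoint_image branch.injective.injOn]
    exact fun w _ w' _ hne => hdisj w w' hne
  · simp only [Finset.forall_mem_map]
    exact fun i _ w _ hne =>
      hadj _ _ (cliqueBipartite_adj.2 ⟨fun h => hne (h ▸ rfl), .inl rfl⟩)

end DominatingModel

section BalancedModel

variable {V : Type*} {G : SimpleGraph V} {S T : Set V} {k m : ℕ}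

/-- `G[S]` has a model with `k` branch sets, half of them (rounded down) dominating. For odd `k`,
moreover, either the half can be rounded up, or one branch set can be given up in exchange for two
vertices of `S` that the remaining ones avoid: this makes the property stable under joins. -/
structure HasBalancedModel (G : SimpleGraph V) (S : Set V) (k : ℕ) : Prop where
  model : HasDominatingModel G S (k / 2) k
  exchange : Odd k → HasDominatingModel G S (k / 2 + 1) k ∨
    ∃ u ∈ S, ∃ v ∈ S, u ≠ v ∧ HasDominatingModel G (S \ {u, v}) (k / 2) (k - 1)

lemma HasDominatingModel.insert_two_edges {a b : ℕ} {u u' v v' : V}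
    (hS : HasDominatingModel G (S \ {u, u'}) a k) (hT : HasDominatingModel G (T \ {v, v'}) b m)
    (hST : G.IsCompleteBetween S T) (hu : u ∈ S) (hu' : u' ∈ S) (huu' : u ≠ u')
    (hv : v ∈ T) (hv' : v' ∈ T) (hvv' : v ≠ v') :
    HasDominatingModel G (S ∪ T) (a + b + 2) (k + m + 2) := by
  have hS₁ : insert u (S \ {u, u'}) ⊆ S := Set.insert_subset hu Set.sdiff_subset
  have hT₁ : insert v (T \ {v, v'}) ⊆ T := Set.insert_subset hv Set.sdiff_subset
  have hS₂ : insert u' (insert u (S \ {u, u'})) ⊆ S := Set.insert_subset hu' hS₁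
  have hT₂ : insert v' (insert v (T \ {v, v'})) ⊆ T := Set.insert_subset hv' hT₁
  have hjoin := hS.join hT fun x hx y hy => hST hx.1 hy.1
  have hedge := hjoin.insert_edge (fun x hx y hy => hST (hS₁ hx) (hT₁ hy)) (by simp) (by simp)
  refine (hedge.insert_edge (fun x hx y hy => hST (hS₂ hx) (hT₂ hy)) ?_ ?_).mono
    (Set.union_subset_union hS₂ hT₂)
  · simp [huu'.symm]
  · simp [hvv'.symm]

namespace HasBalancedModel

lemma join_of_even_of_odd (hS : HasBalancedModel G S k) (hT : HasBalancedModel G T m)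
    (hST : G.IsCompleteBetween S T) (hk : Even k) (hm : Odd m) :
    HasBalancedModel G (S ∪ T) (k + m) := by
  have hk₂ := Nat.even_iff.1 hk
  have hm₂ := Nat.odd_iff.1 hm
  refine ⟨(hS.model.join hT.model hST).of_le (by omega) le_rfl (by omega), fun _ => ?_⟩
  rcases hT.exchange hm with h | ⟨u, hu, v, hv, huv, h⟩
  · exact .inl ((hS.model.join h hST).of_le (by omega) le_rfl (by omega))
  · have hdisj : Disjoint S {u, v} :=
      hST.disjoint.mono_right (Set.insert_subset hu (Set.singleton_subset_iff.2 hv))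
    have hjoin := hS.model.join h fun x hx y hy => hST hx hy.1
    rw [← hdisj.sdiff_eq_left, ← Set.union_sdiff_distrib] at hjoin
    exact .inr ⟨u, .inr hu, v, .inr hv, huv, hjoin.of_le (by omega) (by omega) (by omega)⟩

lemma join_of_odd_of_odd (hS : HasBalancedModel G S k) (hT : HasBalancedModel G T m)
    (hST : G.IsCompleteBetween S T) (hk : Odd k) (hm : Odd m) :
    HasBalancedModel G (S ∪ T) (k + m) := by
  have hk₂ := Nat.odd_iff.1 hk
  have hm₂ := Nat.odd_iff.1 hm
  refine ⟨?_, fun h => absurd (hk.add_odd hm) (Nat.not_even_iff_odd.2 h)⟩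
  rcases hS.exchange hk with h | ⟨u, hu, u', hu', huu', h⟩
  · exact (h.join hT.model hST).of_le (by omega) le_rfl (by omega)
  rcases hT.exchange hm with h' | ⟨v, hv, v', hv', hvv', h'⟩
  · exact (hS.model.join h' hST).of_le (by omega) le_rfl (by omega)
  · exact (h.insert_two_edges h' hST hu hu' huu' hv hv' hvv').of_le
      (by omega) (by omega) (by omega)

lemma join (hS : HasBalancedModel G S k) (hT : HasBalancedModel G T m)
    (hST : G.IsCompleteBetween S T) : HasBalancedModel G (S ∪ T) (k + m) := by
  rcases Nat.even_or_odd k with hk | hk <;> rcases Nat.even_or_odd m with hm | hm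
  · have := Nat.even_iff.1 hk
    exact ⟨(hS.model.join hT.model hST).of_le (by omega) le_rfl (by omega),
      fun h => absurd (hk.add hm) (Nat.not_even_iff_odd.2 h)⟩
  · exact hS.join_of_even_of_odd hT hST hk hm
  · rw [Set.union_comm, add_comm]
    exact hT.join_of_even_of_odd hS hST.symm hm hk
  · exact hS.join_of_odd_of_odd hT hST hk hm

lemma biUnion {ι : Type*} {s : Finset ι} {S : ι → Set V} {k : ι → ℕ}
    (hS : ∀ i ∈ s, HasBalancedModel G (S i) (k i))
    (hcomplete : (s : Set ι).Pairwise fun i j => G.IsCompleteBetween (S i) (S j)) :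
    HasBalancedModel G (⋃ i ∈ s, S i) (∑ i ∈ s, k i) := by
  classical
  induction s using Finset.induction_on with
  | empty =>
    exact ⟨⟨∅, ∅, ⟨by simp, by simp, by simp, by simp, by simp⟩, by simp, by simp⟩, by simp⟩
  | insert i s hi ih =>
    rw [Finset.set_biUnion_insert, Finset.sum_insert hi]
    rw [Finset.coe_insert] at hcomplete
    refine (hS i (Finset.mem_insert_self i s)).join
      (ih (fun j hj => hS j (Finset.mem_insert_of_mem hj))
        (hcomplete.mono (Set.subset_insert i s))) fun x hx y hy => ?_
    obtain ⟨j, hj, hy⟩ := Set.mem_iUnion₂.1 hy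
    exact hcomplete (.inl rfl) (.inr hj) (fun h => hi (h ▸ hj)) hx hy

end HasBalancedModel

lemma hasBalancedModel_of_forall_hasDominatingModel [Finite V]
    (h : ∀ S : Set V, HasDominatingModel G S ((S.ncard + 1) / 2 / 2) ((S.ncard + 1) / 2))
    (S : Set V) : HasBalancedModel G S ((S.ncard + 1) / 2) := by
  refine ⟨h S, fun hodd => ?_⟩
  have hodd₂ := Nat.odd_iff.1 hodd
  obtain hone | hlt : S.ncard = 1 ∨ 1 < S.ncard := by omega
  · obtain ⟨v, rfl⟩ := Set.ncard_eq_one.1 hone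
    have hv : HasDominatingModel G ({v} : Finset V) 1 1 :=
      hasDominatingModel_of_forall_adj (s := {v}) (t := {v}) subset_rfl (by simp)
    left
    simpa using hv
  · obtain ⟨u, v, hu, hv, huv⟩ := (Set.one_lt_ncard_iff).1 hlt
    have hcard : (S \ {u, v}).ncard = S.ncard - 2 := by
      rw [Set.ncard_sdiff (Set.insert_subset hu (Set.singleton_subset_iff.2 hv)),
        Set.ncard_pair huv]
    have hmodel := h (S \ {u, v})
    rw [hcard] at hmodel
    exact .inr ⟨u, hu, v, hv, huv, hmodel.of_le (by omega) (by omega) (by omega)⟩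

end BalancedModel

section TutteBerge

variable {V : Type u} {G : SimpleGraph V} {k : ℕ}

lemma colorable_of_isPerfectMatching_compl [Fintype V] {M : Gᶜ.Subgraph}
    (hM : M.IsPerfectMatching) : G.Colorable (Fintype.card V / 2) := by
  classical
  choose partner hpartner using fun v => (Subgraph.isPerfectMatching_iff.1 hM v).exists
  let C : G.Coloring M.spanningCoe.edgeSet :=
    Coloring.mk (fun v => ⟨s(v, partner v), hpartner v⟩) <| by
      intro v w hvw heq
      rcases Sym2.eq_iff.1 (congrArg Subtype.val heq) with ⟨h, -⟩ | ⟨-, h⟩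
      · exact hvw.ne h
      · exact ((compl_adj _ _ _).1 (h ▸ (hpartner v).adj_sub)).2 hvw
  have hdegree := M.spanningCoe.sum_degrees_eq_twice_card_edges
  simp only [Subgraph.degree_spanningCoe, Subgraph.isPerfectMatching_iff_forall_degree.1 hM,
    Finset.sum_const, Finset.card_univ, smul_eq_mul, mul_one] at hdegree
  have hcard : Fintype.card V / 2 = Fintype.card M.spanningCoe.edgeSet := by
    rw [← edgeFinset_card]
    omega
  exact hcard ▸ C.colorable

lemma sum_ncard_supp [Finite V] (G : SimpleGraph V) [Fintype G.ConnectedComponent] :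
    ∑ c : G.ConnectedComponent, c.supp.ncard = Nat.card V :=
  Nat.card_sigma.symm.trans (Nat.card_congr (Equiv.sigmaFiberEquiv G.connectedComponentMk))

lemma two_mul_sum_half_ncard_supp [Finite V] (G : SimpleGraph V) [Fintype G.ConnectedComponent] :
    2 * ∑ c : G.ConnectedComponent, (c.supp.ncard + 1) / 2 =
      Nat.card V + G.oddComponents.ncard := by
  classical
  have hodd : G.oddComponents.ncard =
      ∑ c : G.ConnectedComponent, if Odd c.supp.ncard then 1 else 0 := by
    rw [← Finset.card_filter, ← Set.ncard_coe_finset, Finset.coe_filter_univ]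
  rw [hodd, ← sum_ncard_supp G, ← Finset.sum_add_distrib, Finset.mul_sum]
  refine Finset.sum_congr rfl fun c _ => ?_
  split_ifs with h <;> rw [Nat.odd_iff] at h <;> omega

lemma exists_isCompleteBetween_of_card_eq [Fintype V] (hcard : Fintype.card V = 2 * k)
    (hG : ¬ G.Colorable k) :
    ∃ (ι : Type u) (_ : Fintype ι) (S : ι → Set V),
      Pairwise (fun i j => G.IsCompleteBetween (S i) (S j)) ∧
      k < ∑ i, ((S i).ncard + 1) / 2 := by
  classical
  have hmatching : ¬ ∃ M : Gᶜ.Subgraph, M.IsPerfectMatching := by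
    rintro ⟨M, hM⟩
    have hcol := colorable_of_isPerfectMatching_compl hM
    rw [hcard, Nat.mul_div_cancel_left k two_pos] at hcol
    exact hG hcol
  obtain ⟨U, hU⟩ : ∃ U, Gᶜ.IsTutteViolator U := by simpa [tutte] using hmatching
  let D := (⊤ : Gᶜ.Subgraph).deleteVerts U
  have hU : U.ncard < D.coe.oddComponents.ncard := hU
  have hverts : U.ncard + Nat.card D.verts = 2 * k := by
    rw [Nat.card_coe_set_eq, Subgraph.deleteVerts_verts, Subgraph.verts_top,
      ← Set.compl_eq_univ_sdiff, Set.ncard_add_ncard_compl, Nat.card_eq_fintype_card, hcard]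
  refine ⟨D.coe.ConnectedComponent, Fintype.ofFinite _, fun c => (↑) '' c.supp, ?_, ?_⟩
  · rintro c c' hne _ ⟨x, rfl, rfl⟩ _ ⟨y, rfl, rfl⟩
    by_contra hxy
    have hadj : D.coe.Adj x y := by
      refine Subgraph.deleteVerts_adj.2 ⟨trivial, x.2.2, trivial, y.2.2, ?_⟩
      exact (compl_adj _ _ _).2 ⟨fun h => hne (congrArg _ (Subtype.ext h)), hxy⟩
    exact hne (ConnectedComponent.sound hadj.reachable)
  · simp only [Set.ncard_image_of_injective _ Subtype.val_injective]
    have := @two_mul_sum_half_ncard_supp _ _ D.coe (Fintype.ofFinite _)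
    omega

lemma notMem_of_forall_not_adj [Finite V] {ι : Type*} [Fintype ι] {S : ι → Set V}
    (hcard : Nat.card V ≤ 2 * k)
    (hS : Pairwise fun i j => G.IsCompleteBetween (S i) (S j))
    (hsum : k < ∑ i, ((S i).ncard + 1) / 2) {v : V} (hv : ∀ w, ¬ G.Adj v w) (i : ι) :
    v ∉ S i := by
  intro hvi
  have hempty : ∀ j ≠ i, S j = ∅ := fun j hj =>
    Set.eq_empty_of_forall_notMem fun w hw => hv w (hS hj.symm hvi hw)
  rw [Finset.sum_eq_single i (fun j _ hj => by simp [hempty j hj]) (by simp)] at hsum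
  have := Set.ncard_le_card (S i)
  omega

/-- One half of the Tutte–Berge formula for the complement of `G`. -/
lemma exists_isCompleteBetween_of_not_colorable [Fintype V] (hcard : Fintype.card V ≤ 2 * k)
    (hG : ¬ G.Colorable k) :
    ∃ (ι : Type u) (_ : Fintype ι) (S : ι → Set V),
      Pairwise (fun i j => G.IsCompleteBetween (S i) (S j)) ∧
      k < ∑ i, ((S i).ncard + 1) / 2 := by
  obtain ⟨d, hd⟩ := Nat.exists_eq_add_of_le hcard
  let P : SimpleGraph (V ⊕ Fin d) := G ⊕g ⊥
  have hPcard : Fintype.card (V ⊕ Fin d) = 2 * k := by simp [hd]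
  obtain ⟨ι, _, S, hS, hsum⟩ :=
    exists_isCompleteBetween_of_card_eq (G := P) hPcard fun h => hG h.of_sum_left
  have hrange : ∀ i, S i ⊆ Set.range Sum.inl := by
    rintro i (v | j) hx
    · exact ⟨v, rfl⟩
    · refine absurd hx (notMem_of_forall_not_adj (by simp [hd]) hS hsum ?_ i)
      rintro (v | j') <;> simp [P]
  refine ⟨ι, inferInstance, fun i => Sum.inl ⁻¹' S i, fun i j hij v hv w hw => ?_, ?_⟩
  · exact sum_adj_inl.1 (hS hij hv hw)
  · simpa only [Set.ncard_preimage_of_injective_subset_range Sum.inl_injective (hrange _)]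

lemma hasDominatingModel_of_not_colorable [Finite V]
    (h : ∀ S : Set V, HasDominatingModel G S ((S.ncard + 1) / 2 / 2) ((S.ncard + 1) / 2))
    (hG : ¬ G.Colorable k) : HasDominatingModel G Set.univ ((k + 1) / 2) (k + 1) := by
  have := Fintype.ofFinite V
  rcases Nat.lt_or_ge (2 * k) (Fintype.card V) with hlt | hle
  · have huniv := h Set.univ
    rw [Set.ncard_univ, Nat.card_eq_fintype_card] at huniv
    exact huniv.of_le (by omega) (by omega) (by omega)
  · obtain ⟨ι, _, S, hS, hsum⟩ := exists_isCompleteBetween_of_not_colorable hle hG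
    have hmodel := (HasBalancedModel.biUnion (s := Finset.univ)
      (fun i _ => hasBalancedModel_of_forall_hasDominatingModel h (S i)) (hS.set_pairwise _)).model
    exact (hmodel.mono (Set.subset_univ _)).of_le (by omega) (by omega) (by omega)

end TutteBerge

section IndependenceNumber

variable {V : Type*} {G : SimpleGraph V} {k : ℕ}

lemma indepNum_le_of_embedding {W : Type*} [Finite V] {H : SimpleGraph W} (φ : H ↪g G) :
    H.indepNum ≤ G.indepNum := by
  classical
  obtain ⟨s, hs⟩ := H.exists_isNIndepSet_indepNum
  rw [← hs.card_eq, ← Finset.card_map φ.toEmbedding]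
  refine IsIndepSet.card_le_indepNum ?_
  rw [Finset.coe_map]
  rintro _ ⟨x, hx, rfl⟩ _ ⟨y, hy, rfl⟩ hne h
  exact hs.isIndepSet hx hy (fun h => hne (h ▸ rfl)) (φ.map_adj_iff.1 h)

lemma adj_of_indepNum_le_one [Finite V] (hG : G.indepNum ≤ 1) {x y : V} (hne : x ≠ y) :
    G.Adj x y := by
  classical
  by_contra hxy
  have hindep : G.IsIndepSet (({x, y} : Finset V) : Set V) := by
    simpa [IsIndepSet, Set.pairwise_pair, adj_comm] using fun _ => hxy
  have := hindep.card_le_indepNum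
  rw [Finset.card_pair hne] at this
  omega

lemma card_le_indepNum_mul_of_colorable [Fintype V] (hG : G.Colorable k) :
    Fintype.card V ≤ G.indepNum * k := by
  classical
  obtain ⟨C⟩ := hG
  have hfiber : ∀ c ∈ Finset.univ, (Finset.univ.filter (C · = c)).card ≤ G.indepNum := by
    refine fun c _ => IsIndepSet.card_le_indepNum fun x hx y hy _ hxy => C.valid hxy ?_
    rw [Finset.coe_filter_univ] at hx hy
    exact hx.trans hy.symm
  simpa using Finset.card_le_mul_card_image_of_maps_to (f := C) (s := Finset.univ)
    (t := Finset.univ) (by simp) G.indepNum hfiber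

end IndependenceNumber

lemma natCeil_natCast_div_two (n : ℕ) : ⌈(n : ℚ) / 2⌉₊ = (n + 1) / 2 := by
  refine eq_of_forall_ge_iff fun c => ?_
  rw [Nat.ceil_le, div_le_iff₀ two_pos]
  norm_cast
  omega

lemma hasDominatingModel_univ_of_orderVersion (hA : OrderVersion.{u}) {V : Type u} [Finite V]
    {G : SimpleGraph V} (hG : G.indepNum ≤ 2) :
    HasDominatingModel G Set.univ ((Nat.card V + 1) / 2 / 2) ((Nat.card V + 1) / 2) := by
  have := Fintype.ofFinite V
  rw [Nat.card_eq_fintype_card]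
  obtain hone | htwo : G.indepNum ≤ 1 ∨ G.indepNum = 2 := by omega
  · have hclique : HasDominatingModel G (Finset.univ : Finset V) _ _ :=
      hasDominatingModel_of_forall_adj subset_rfl fun x _ y _ => adj_of_indepNum_le_one hone
    rw [Finset.coe_univ, Finset.card_univ] at hclique
    exact hclique.of_le (by omega) (by omega) (by omega)
  rcases Nat.eq_zero_or_pos ((Fintype.card V + 1) / 2 / 2) with hzero | hpos
  · have hsingletons : HasDominatingModel G (Finset.univ : Finset V) _ _ :=
      hasDominatingModel_of_forall_adj (Finset.empty_subset _) (by simp)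
    rw [Finset.coe_univ, Finset.card_univ] at hsingletons
    exact hsingletons.of_le (by simp [hzero]) (by omega) (by omega)
  · have hminor := hA V G htwo _ hpos (by rw [natCeil_natCast_div_two]; omega)
    rw [natCeil_natCast_div_two] at hminor
    exact (hasDominatingModel_of_isGraphMinor hminor).of_le le_rfl (by omega) (by omega)

lemma hasDominatingModel_of_orderVersion (hA : OrderVersion.{u}) {V : Type u} [Finite V]
    {G : SimpleGraph V} (hG : G.indepNum ≤ 2) (S : Set V) :
    HasDominatingModel G S ((S.ncard + 1) / 2 / 2) ((S.ncard + 1) / 2) := by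
  have hinduce := hasDominatingModel_univ_of_orderVersion hA (G := G.induce S)
    ((indepNum_le_of_embedding (Embedding.induce S)).trans hG)
  rw [Nat.card_coe_set_eq] at hinduce
  exact (hinduce.map (Embedding.induce S)).mono (by rintro _ ⟨x, -, rfl⟩; exact x.2)

theorem chromaticVersion_of_orderVersion (hA : OrderVersion.{u}) : ChromaticVersion.{u} := by
  intro V _ G hG k hk ℓ _ hℓk
  have hcol : ¬ G.Colorable (k - 1) := fun h => by
    have := hk ▸ chromaticNumber_le_iff_colorable.2 h
    norm_cast at this
    omega
  have hmodel := hasDominatingModel_of_not_colorable (hasDominatingModel_of_orderVersion hA hG) hcol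
  exact (hmodel.of_le (by omega) (by omega) (by omega)).isGraphMinor

theorem orderVersion_of_chromaticVersion (hB : ChromaticVersion.{u}) : OrderVersion.{u} := by
  intro V _ G hG ℓ hℓ hℓn
  rw [natCeil_natCast_div_two] at hℓn ⊢
  obtain ⟨k, hk⟩ := ENat.ne_top_iff_exists.1
    (chromaticNumber_ne_top_iff_exists.2 ⟨_, G.colorable_of_fintype⟩)
  have hcard : Fintype.card V ≤ 2 * k :=
    hG ▸ card_le_indepNum_mul_of_colorable (chromaticNumber_le_iff_colorable.1 hk.ge)
  have hmodel := hasDominatingModel_of_isGraphMinor (hB V G hG.le k hk.symm ℓ hℓ (by omega))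
  exact (hmodel.of_le le_rfl (by omega) (by omega)).isGraphMinor

theorem mainTheorem3 :
    SimpleGraph.OrderVersion.{u} ↔ SimpleGraph.ChromaticVersion.{u} :=
  ⟨chromaticVersion_of_orderVersion, orderVersion_of_chromaticVersion⟩
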